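/- For real $a,b,c$ put $T(a,b,c)=\sum_{r=1}^{\infty}\sum_{s=1}^{\infty}\frac{1}{r^{a}s^{b}(r+s)^{c}}$, whenever the series converges. Let $\zeta(z,q)$ denote the Hurwitz zeta function (the meromorphic continuation in $z$ of $\sum_{n\ge 0}(n+q)^{-z}$), $\zeta(z)=\zeta(z,1)$ the Riemann zeta function, $B(a,c)$ the Euler beta function, and $$\lambda(z)=\frac{\Gamma(1-z)}{(2\pi)^{1-z}}=\frac{\pi}{(2\pi)^{1-z}\,\Gamma(z)\sin \pi z}.$$ **Theorem.** Let $a,c>2$ be real numbers that are not integers. Then the double series $T(a,0,c)$ converges, the integral below converges absolutely, and $$ T(a,0,c)=4\lambda(a)\lambda(c)\sin\left(\tfrac{\pi c}{2}\right)\Bigg[\sin\left(\tfrac{\pi a}{2}\right)\left\{\zeta(1-a)\zeta(1-c)-\frac{\zeta(1-a-c)B(a,c)}{1-\tan\left(\frac{\pi a}{2}\right)\tan\left(\frac{\pi c}{2}\right)}\right\}-\frac12\cos\left(\tfrac{\pi a}{2}\right)\int_0^1\big[\zeta(1-a,q)-\zeta(1-a,1-q)\big]\zeta(1-c,q)\cot(\pi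 q)\,dq\Bigg]. $$ The denominator $1-\tan(\frac{\pi a}{2})\tan(\frac{\pi c}{2})$ vanishes exactly when $a+c$ is an odd integer. In that case the quotient $\frac{\zeta(1-x-c)B(x,c)}{1-\tan(\pi x/2)\tan(\pi c/2)}$ has a finite limit as $x\to a$, $x\neq a$, and the formula holds with the quotient replaced by this limit. -/

import Mathlib

open Filter Topology

noncomputable section

namespace Tornheim

/-- The `(r+1, s+1)`-st term of the Tornheim double series, `r, s = 0, 1, 2, …`. -/
def term (a b c : ℝ) (r s : ℕ) : ℝ :=
  1 / (((r : ℝ) + 1) ^ a * ((s : ℝ) + 1) ^ b * (((r : ℝ) + 1) + ((s : ℝ) + 1)) ^ c)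

/-- The Tornheim double series `T(a,b,c) = ∑_{r ≥ 1} ∑_{s ≥ 1} 1 / (r^a s^b (r+s)^c)`. -/
def T (a b c : ℝ) : ℝ := ∑' r : ℕ, ∑' s : ℕ, term a b c r s

/-- `λ(z) = Γ(1-z) / (2π)^(1-z)`. -/
def lam (z : ℝ) : ℝ := Real.Gamma (1 - z) / (2 * Real.pi) ^ (1 - z)

/-- The second expression for `λ`. -/
theorem lam_eq {z : ℝ} (hz : 0 < z) :
    lam z = Real.pi / ((2 * Real.pi) ^ (1 - z) * Real.Gamma z * Real.sin (Real.pi * z)) := by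
  have h := Real.Gamma_mul_Gamma_one_sub z
  have hG : Real.Gamma z ≠ 0 := (Real.Gamma_pos_of_pos hz).ne'
  have h1 : Real.Gamma (1 - z) = Real.pi / Real.sin (Real.pi * z) / Real.Gamma z := by
    rw [← h]; field_simp
  unfold lam
  rw [h1, div_div, div_div]
  congr 1
  ring

/-- The denominator `1 - tan(πa/2) tan(πc/2)`. For `a`, `c` not integers it vanishes exactly when
`a + c` is an odd integer. -/
def denom (a c : ℝ) : ℝ := 1 - Real.tan (Real.pi * a / 2) * Real.tan (Real.pi * c / 2)

/-- The quotient `ζ(1-a-c) B(a,c) / (1 - tan(πa/2) tan(πc/2))`. -/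
def quot (a c : ℝ) : ℂ :=
  riemannZeta (1 - a - c) * Complex.betaIntegral a c / (denom a c : ℂ)

/-- The integrand `[ζ(1-a,q) - ζ(1-a,1-q)] ζ(1-c,q) cot(πq)`. For `0 < q < 1`, Mathlib's
`HurwitzZeta.hurwitzZeta q` is the meromorphic continuation of `s ↦ ∑_{n ≥ 0} 1 / (n + q)^s`. -/
def integrand (a c q : ℝ) : ℂ :=
  (HurwitzZeta.hurwitzZeta (q : UnitAddCircle) (1 - a)
      - HurwitzZeta.hurwitzZeta ((1 - q : ℝ) : UnitAddCircle) (1 - a))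
    * HurwitzZeta.hurwitzZeta (q : UnitAddCircle) (1 - c) * (Real.cot (Real.pi * q) : ℂ)

/-- The right-hand side of the formula, with `D` in the place of the quotient
`ζ(1-a-c) B(a,c) / (1 - tan(πa/2) tan(πc/2))`. -/
def rhs (a c : ℝ) (D : ℂ) : ℂ :=
  4 * (lam a : ℂ) * (lam c : ℂ) * (Real.sin (Real.pi * c / 2) : ℂ) *
    ((Real.sin (Real.pi * a / 2) : ℂ) *
        (riemannZeta (1 - a) * riemannZeta (1 - c) - D)
      - 1 / 2 * (Real.cos (Real.pi * a / 2) : ℂ) * ∫ q in (0 : ℝ)..1, integrand a c q)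

end Tornheim

end

/-! Write K(a) = 2Γ(a)/(2π)^a (`functionalCoeff`). By the functional equations the difference in the
integrand is 2K(a) sin(πa/2) ∑ sin(2πnq)/n^a, and ζ(1-c,q) is a combination of ∑ e^(±2πimq)/m^c. The
cotangent turns each sin(2πnq) into the cosine polynomial 1 + 2∑_{0<j<n} cos(2πjq) + cos(2πnq), for
n ≥ 1. Orthogonality then keeps the pairs m < n with weight 1 and m = n with weight 1/2; call the
resulting sum W (`weightedSum`).

With n = r and m = r+s, T(a,0,c) is the sum over n < m, so T = ζ(a)ζ(c) - ζ(a+c)/2 - W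
(`T_eq_zeta_mul_zeta_sub`). The relation λ(a)K(a) sin(πa) = 1 converts this into the formula. The
quotient equals K(a)K(c) cos(πa/2) cos(πc/2) ζ(a+c)/2 wherever it is defined; this is continuous in
a, hence the limit when a+c is odd. -/

namespace Tornheim

open Real MeasureTheory

/-! ### Fourier analysis of the cotangent kernel -/

/-- The trigonometric polynomial that agrees with `sin (2 π n q) * cot (π q)` off the integers. -/
noncomputable def sinCotKernel (n : ℕ) (q : ℝ) : ℝ :=
  ∑ j ∈ Finset.range n, (cos (2 * π * j * q) + cos (2 * π * (j + 1) * q))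

theorem sin_mul_cot_eq_sinCotKernel (n : ℕ) {q : ℝ} (hq : sin (π * q) ≠ 0) :
    sin (2 * π * q * n) * cot (π * q) = sinCotKernel n q := by
  -- Both sides equal 2 sin(πq) cos(πq) cos((2j+1)πq); the right side telescopes over j.
  have h (j : ℕ) : sin (π * q) * (cos (2 * π * j * q) + cos (2 * π * (j + 1) * q)) =
      cos (π * q) * (sin (2 * π * q * (j + 1 : ℕ)) - sin (2 * π * q * j)) := by
    have e1 : 2 * π * j * q = (2 * j + 1) * π * q - π * q := by ring
    have e2 : 2 * π * (j + 1) * q = (2 * j + 1) * π * q + π * q := by ring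
    have e3 : 2 * π * q * (j + 1 : ℕ) = (2 * j + 1) * π * q + π * q := by push_cast; ring
    have e4 : 2 * π * q * j = (2 * j + 1) * π * q - π * q := by ring
    rw [e1, e2, e3, e4, cos_sub, cos_add, sin_sub, sin_add]
    ring
  have hsum : sin (π * q) * sinCotKernel n q = cos (π * q) * sin (2 * π * q * n) := by
    rw [sinCotKernel, Finset.mul_sum, Finset.sum_congr rfl fun j _ => h j, ← Finset.mul_sum,
      Finset.sum_range_sub (fun j : ℕ => sin (2 * π * q * j))]
    simp
  rw [cot_eq_cos_div_sin, mul_div_assoc', div_eq_iff hq]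
  linarith

theorem abs_sinCotKernel_le (n : ℕ) (q : ℝ) : |sinCotKernel n q| ≤ 2 * n := by
  refine (Finset.abs_sum_le_sum_abs _ _).trans ?_
  have h (j : ℕ) : |cos (2 * π * j * q) + cos (2 * π * (j + 1) * q)| ≤ 2 := by
    refine (abs_add_le _ _).trans ?_
    linarith [abs_cos_le_one (2 * π * j * q), abs_cos_le_one (2 * π * (j + 1) * q)]
  refine (Finset.sum_le_sum fun j _ => h j).trans ?_
  simp [mul_comm]

theorem continuous_sinCotKernel (n : ℕ) : Continuous (sinCotKernel n) := by
  unfold sinCotKernel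
  fun_prop

theorem integral_exp_two_pi_mul_int (k : ℤ) :
    ∫ q in (0 : ℝ)..1, Complex.exp (2 * π * Complex.I * k * q) = if k = 0 then 1 else 0 := by
  split_ifs with h
  · simp [h]
  · rw [integral_exp_mul_complex (by simp [h, pi_ne_zero])]
    have : (2 * π * Complex.I * k : ℂ) = k * (2 * π * Complex.I) := by ring
    simp [this, Complex.exp_int_mul_two_pi_mul_I]

theorem integral_cos_mul_exp (j : ℕ) (k : ℤ) :
    ∫ q in (0 : ℝ)..1, (cos (2 * π * j * q) : ℂ) * Complex.exp (2 * π * Complex.I * k * q) =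
      ((if k + j = 0 then 1 else 0) + (if k - j = 0 then 1 else 0)) / 2 := by
  have h (q : ℝ) : (cos (2 * π * j * q) : ℂ) * Complex.exp (2 * π * Complex.I * k * q) =
      (Complex.exp (2 * π * Complex.I * (k + j : ℤ) * q) +
        Complex.exp (2 * π * Complex.I * (k - j : ℤ) * q)) / 2 := by
    push_cast
    rw [Complex.cos, div_mul_eq_mul_div, add_mul, ← Complex.exp_add, ← Complex.exp_add]
    ring_nf
  simp_rw [h]
  rw [intervalIntegral.integral_div, intervalIntegral.integral_add,
    integral_exp_two_pi_mul_int, integral_exp_two_pi_mul_int]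
  all_goals exact Continuous.intervalIntegrable (by fun_prop) _ _

/-- `1` below the diagonal, `1 / 2` on the diagonal, `0` above it. -/
noncomputable def halfWeight (n m : ℕ) : ℝ :=
  (if m < n then 1 / 2 else 0) + (if m ≤ n then 1 / 2 else 0)

theorem integral_sinCotKernel_mul_exp (n : ℕ) {m : ℕ} (hm : m ≠ 0) {k : ℤ} (hk : k.natAbs = m) :
    ∫ q in (0 : ℝ)..1, (sinCotKernel n q : ℂ) * Complex.exp (2 * π * Complex.I * k * q) =
      halfWeight n m := by
  simp only [sinCotKernel, Complex.ofReal_sum, Finset.sum_mul, Complex.ofReal_add, add_mul]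
  rw [intervalIntegral.integral_finsetSum]
  swap
  · exact fun _ _ => Continuous.intervalIntegrable (by fun_prop) _ _
  have h (j : ℕ) : ∫ q in (0 : ℝ)..1,
      ((cos (2 * π * j * q) : ℂ) * Complex.exp (2 * π * Complex.I * k * q) +
        (cos (2 * π * (j + 1) * q) : ℂ) * Complex.exp (2 * π * Complex.I * k * q)) =
      (if m = j then 1 / 2 else 0) + (if m - 1 = j then 1 / 2 else 0) := by
    rw [intervalIntegral.integral_add, integral_cos_mul_exp]
    · have := integral_cos_mul_exp (j + 1) k
      push_cast at this ⊢
      rw [this]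
      -- Since k = ±m with m ≠ 0, at most one of the two exponents vanishes for each cosine, and `m
      -- - 1 = j` really means j + 1 = m.
      rcases Int.natAbs_eq k with h | h <;> split_ifs <;> first | omega | norm_num
    all_goals exact Continuous.intervalIntegrable (by fun_prop) _ _
  rw [Finset.sum_congr rfl fun j _ => h j, Finset.sum_add_distrib, Finset.sum_ite_eq,
    Finset.sum_ite_eq, halfWeight]
  have hmn : m - 1 < n ↔ m ≤ n := by omega
  simp only [Finset.mem_range, hmn]
  split_ifs <;> norm_num

theorem abs_halfWeight_le (n m : ℕ) : |halfWeight n m| ≤ 1 := by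
  unfold halfWeight
  split_ifs <;> norm_num

/-! ### Dirichlet coefficients and periodic zeta series -/

/-- The coefficient `1 / n ^ a`, which is `0` at `n = 0` when `a ≠ 0`. -/
noncomputable def powCoeff (a : ℝ) (n : ℕ) : ℝ := 1 / (n : ℝ) ^ a

theorem powCoeff_nonneg (a : ℝ) (n : ℕ) : 0 ≤ powCoeff a n := by unfold powCoeff; positivity

theorem powCoeff_zero {a : ℝ} (ha : a ≠ 0) : powCoeff a 0 = 0 := by simp [powCoeff, ha]

theorem summable_powCoeff {a : ℝ} (ha : 1 < a) : Summable (powCoeff a) :=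
  summable_one_div_nat_rpow.2 ha

theorem powCoeff_mul_powCoeff (a c : ℝ) (n : ℕ) (ha : 0 < a) (hc : 0 < c) :
    powCoeff a n * powCoeff c n = powCoeff (a + c) n := by
  rw [powCoeff, powCoeff, powCoeff, rpow_add_of_nonneg n.cast_nonneg ha.le hc.le]
  field_simp

theorem powCoeff_cast (a : ℝ) (n : ℕ) : (powCoeff a n : ℂ) = 1 / (n : ℂ) ^ (a : ℂ) := by
  rw [powCoeff]
  push_cast
  rw [Complex.ofReal_cpow n.cast_nonneg]
  simp

/-- The factor 2n is the bound on the kernel. It costs one power of n, which is why a > 2 is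
required. -/
theorem summable_mul_powCoeff {a : ℝ} (ha : 2 < a) :
    Summable fun n : ℕ => 2 * (n : ℝ) * powCoeff a n := by
  refine ((summable_powCoeff (a := a - 1) (by linarith)).mul_left 2).congr fun n => ?_
  rcases Nat.eq_zero_or_pos n with rfl | hn
  · simp [powCoeff, show a - 1 ≠ 0 by linarith]
  · have : (0 : ℝ) < n := by exact_mod_cast hn
    rw [powCoeff, powCoeff, rpow_sub_one this.ne']
    field_simp

theorem hasSum_expZeta_powCoeff {c : ℝ} (hc : 1 < c) (q : ℝ) :
    HasSum (fun n : ℕ => (powCoeff c n : ℂ) * Complex.exp (2 * π * Complex.I * q * n))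
      (HurwitzZeta.expZeta q c) := by
  refine (HurwitzZeta.hasSum_expZeta_of_one_lt_re q (s := c) (by simpa)).congr_fun fun n => ?_
  rw [powCoeff_cast]
  ring

theorem hasSum_sinZeta_powCoeff {a : ℝ} (ha : 1 < a) (q : ℝ) :
    HasSum (fun n : ℕ => (powCoeff a n : ℂ) * (sin (2 * π * q * n) : ℂ))
      (HurwitzZeta.sinZeta q a) := by
  refine (HurwitzZeta.hasSum_nat_sinZeta q (s := a) (by simpa)).congr_fun fun n => ?_
  rw [powCoeff_cast]
  ring

theorem riemannZeta_eq_tsum_powCoeff {a : ℝ} (ha : 1 < a) :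
    riemannZeta a = ((∑' n, powCoeff a n : ℝ) : ℂ) := by
  rw [zeta_eq_tsum_one_div_nat_cpow (by simpa), Complex.ofReal_tsum]
  exact tsum_congr fun n => (powCoeff_cast a n).symm

theorem norm_exp_two_pi_mul (q : ℝ) (n : ℕ) :
    ‖Complex.exp (2 * π * Complex.I * q * n)‖ = 1 := by
  rw [Complex.norm_exp]
  simp

theorem continuous_expZeta {c : ℝ} (hc : 1 < c) :
    Continuous fun q : ℝ => HurwitzZeta.expZeta q c := by
  simp_rw [← fun q => (hasSum_expZeta_powCoeff hc q).tsum_eq]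
  refine continuous_tsum (fun n => by fun_prop) (summable_powCoeff hc) fun n q => ?_
  rw [norm_mul, norm_exp_two_pi_mul, mul_one, Complex.norm_real,
    norm_of_nonneg (powCoeff_nonneg _ _)]

/-- The continuous function that agrees with `(∑ sin (2 π n q) / n ^ a) * cot (π q)` off the
integers. -/
noncomputable def sinCotSum (a q : ℝ) : ℂ := ∑' n, ((powCoeff a n * sinCotKernel n q : ℝ) : ℂ)

theorem norm_powCoeff_mul_sinCotKernel_le (a q : ℝ) (n : ℕ) :
    ‖((powCoeff a n * sinCotKernel n q : ℝ) : ℂ)‖ ≤ 2 * n * powCoeff a n := by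
  rw [Complex.norm_real, norm_mul, norm_of_nonneg (powCoeff_nonneg _ _), mul_comm]
  exact mul_le_mul_of_nonneg_right (abs_sinCotKernel_le n q) (powCoeff_nonneg _ _)

theorem continuous_sinCotSum {a : ℝ} (ha : 2 < a) : Continuous (sinCotSum a) := by
  refine continuous_tsum (fun n => ?_) (summable_mul_powCoeff ha)
    fun n q => norm_powCoeff_mul_sinCotKernel_le a q n
  have := continuous_sinCotKernel n
  fun_prop

theorem sinZeta_mul_cot {a q : ℝ} (ha : 1 < a) (hq : sin (π * q) ≠ 0) :
    HurwitzZeta.sinZeta q a * (cot (π * q) : ℂ) = sinCotSum a q := by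
  rw [← ((hasSum_sinZeta_powCoeff ha q).mul_right _).tsum_eq, sinCotSum]
  refine tsum_congr fun n => ?_
  rw [← sin_mul_cot_eq_sinCotKernel n hq]
  push_cast
  ring

/-! ### Termwise integration -/

/-- The value of `∫₀¹ (∑ sin (2 π n q) / n ^ a) (∑ cos (2 π m q) / m ^ c) cot (π q) dq`. -/
noncomputable def weightedSum (a c : ℝ) : ℝ :=
  ∑' p : ℕ × ℕ, halfWeight p.1 p.2 * (powCoeff a p.1 * powCoeff c p.2)

theorem hasSum_sinCotSum {a : ℝ} (ha : 2 < a) (q : ℝ) :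
    HasSum (fun n => ((powCoeff a n * sinCotKernel n q : ℝ) : ℂ)) (sinCotSum a q) :=
  (Summable.of_norm_bounded (summable_mul_powCoeff ha)
    (norm_powCoeff_mul_sinCotKernel_le a q)).hasSum

/-- The terms of the double series for the product of `sinCotSum` and `expZeta`. -/
noncomputable def productTerm (a c : ℝ) (e : ℤ) (p : ℕ × ℕ) (q : ℝ) : ℂ :=
  ((powCoeff a p.1 * sinCotKernel p.1 q : ℝ) : ℂ) *
    ((powCoeff c p.2 : ℂ) * Complex.exp (2 * π * Complex.I * (e * q : ℝ) * p.2))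

theorem continuous_productTerm (a c : ℝ) (e : ℤ) (p : ℕ × ℕ) :
    Continuous (productTerm a c e p) := by
  have := continuous_sinCotKernel p.1
  unfold productTerm
  fun_prop

theorem norm_productTerm_le (a c : ℝ) (e : ℤ) (p : ℕ × ℕ) (q : ℝ) :
    ‖productTerm a c e p q‖ ≤ 2 * (p.1 : ℝ) * powCoeff a p.1 * powCoeff c p.2 := by
  rw [productTerm, norm_mul, norm_mul, norm_exp_two_pi_mul, mul_one,
    Complex.norm_real (powCoeff c _), norm_of_nonneg (powCoeff_nonneg c _)]
  exact mul_le_mul_of_nonneg_right (norm_powCoeff_mul_sinCotKernel_le a q p.1)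
    (powCoeff_nonneg _ _)

theorem summable_productTerm_bound {a c : ℝ} (ha : 2 < a) (hc : 1 < c) :
    Summable fun p : ℕ × ℕ => 2 * (p.1 : ℝ) * powCoeff a p.1 * powCoeff c p.2 :=
  (summable_mul_powCoeff ha).mul_of_nonneg (summable_powCoeff hc)
    (fun _ => mul_nonneg (by positivity) (powCoeff_nonneg _ _)) (fun _ => powCoeff_nonneg _ _)

theorem hasSum_productTerm {a c : ℝ} (ha : 2 < a) (hc : 1 < c) (e : ℤ) (q : ℝ) :
    HasSum (fun p => productTerm a c e p q)
      (sinCotSum a q * HurwitzZeta.expZeta ((e * q : ℝ) : UnitAddCircle) c) := by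
  have h : Summable fun p => productTerm a c e p q :=
    Summable.of_norm_bounded (summable_productTerm_bound ha hc)
      fun p => norm_productTerm_le a c e p q
  have h' := (hasSum_sinCotSum ha q).mul (hasSum_expZeta_powCoeff hc (e * q)) h
  exact h'.congr_fun fun p => rfl

theorem integral_productTerm (a : ℝ) {c : ℝ} (hc : 1 < c) {e : ℤ} (he : e.natAbs = 1)
    (p : ℕ × ℕ) :
    ∫ q in (0 : ℝ)..1, productTerm a c e p q =
      ((halfWeight p.1 p.2 * (powCoeff a p.1 * powCoeff c p.2) : ℝ) : ℂ) := by
  rcases eq_or_ne p.2 0 with h0 | h0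
  · simp [productTerm, h0, powCoeff_zero (show c ≠ 0 by linarith)]
  · have hk : (e * p.2).natAbs = p.2 := by simp [Int.natAbs_mul, he]
    have h := integral_sinCotKernel_mul_exp p.1 h0 hk
    have hq (q : ℝ) : productTerm a c e p q = ((powCoeff a p.1 : ℂ) * powCoeff c p.2) *
        ((sinCotKernel p.1 q : ℂ) *
          Complex.exp (2 * π * Complex.I * (e * p.2 : ℤ) * q)) := by
      have harg : (2 * π * Complex.I * (e * q : ℝ) * p.2 : ℂ) =
          2 * π * Complex.I * (e * p.2 : ℤ) * q := by
        push_cast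
        ring
      rw [productTerm, harg, Complex.ofReal_mul]
      ring
    simp_rw [hq]
    rw [intervalIntegral.integral_const_mul, h, Complex.ofReal_mul, Complex.ofReal_mul]
    ring

/-- The signs e = ±1 give the same value because the Fourier weight depends only on |k|. Dominated
convergence permits termwise integration. -/
theorem integral_sinCotSum_mul_expZeta {a c : ℝ} (ha : 2 < a) (hc : 1 < c) {e : ℤ}
    (he : e.natAbs = 1) :
    ∫ q in (0 : ℝ)..1, sinCotSum a q * HurwitzZeta.expZeta ((e * q : ℝ) : UnitAddCircle) c =
      weightedSum a c := by
  have hsum := intervalIntegral.hasSum_integral_of_dominated_convergence (μ := volume)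
    (a := 0) (b := 1) (F := productTerm a c e)
    (f := fun q => sinCotSum a q * HurwitzZeta.expZeta ((e * q : ℝ) : UnitAddCircle) c)
    (fun p _ => 2 * (p.1 : ℝ) * powCoeff a p.1 * powCoeff c p.2)
    (fun p => (continuous_productTerm a c e p).aestronglyMeasurable)
    (fun p => ae_of_all _ fun q _ => norm_productTerm_le a c e p q)
    (ae_of_all _ fun q _ => summable_productTerm_bound ha hc) intervalIntegrable_const
    (ae_of_all _ fun q _ => hasSum_productTerm ha hc e q)
  rw [← hsum.tsum_eq, weightedSum, Complex.ofReal_tsum]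
  exact tsum_congr fun p => integral_productTerm a hc he p

/-! ### The double series as a sum over n < m -/

theorem summable_powCoeff_mul {a c : ℝ} (ha : 1 < a) (hc : 1 < c) :
    Summable fun p : ℕ × ℕ => powCoeff a p.1 * powCoeff c p.2 :=
  (summable_powCoeff ha).mul_of_nonneg (summable_powCoeff hc)
    (fun _ => powCoeff_nonneg _ _) (fun _ => powCoeff_nonneg _ _)

theorem term_eq_powCoeff (a c : ℝ) (r s : ℕ) :
    term a 0 c r s = powCoeff a (r + 1) * powCoeff c (r + s + 2) := by
  rw [term, powCoeff, powCoeff]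
  push_cast
  rw [show (r : ℝ) + 1 + (s + 1) = r + s + 2 by ring]
  simp
  ring

theorem injective_add_one_add_two :
    Function.Injective fun p : ℕ × ℕ => ((p.1 + 1, p.1 + p.2 + 2) : ℕ × ℕ) := by
  rintro ⟨a, b⟩ ⟨c, d⟩ h
  simp only [Prod.mk.injEq] at h ⊢
  omega

theorem summable_term {a c : ℝ} (ha : 1 < a) (hc : 1 < c) :
    Summable fun p : ℕ × ℕ => term a 0 c p.1 p.2 := by
  have h := (summable_powCoeff_mul ha hc).comp_injective injective_add_one_add_two
  refine h.congr fun p => ?_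
  rw [term_eq_powCoeff, Function.comp_apply]

theorem T_eq_tsum_ite {a c : ℝ} (ha : 1 < a) (hc : 1 < c) :
    T a 0 c = ∑' p : ℕ × ℕ, if p.1 < p.2 then powCoeff a p.1 * powCoeff c p.2 else 0 := by
  rw [T, ← (summable_term ha hc).tsum_prod, ← injective_add_one_add_two.tsum_eq
    (f := fun p : ℕ × ℕ => if p.1 < p.2 then powCoeff a p.1 * powCoeff c p.2 else 0)]
  · refine tsum_congr fun p => ?_
    rw [term_eq_powCoeff, if_pos (show p.1 + 1 < p.1 + p.2 + 2 by omega)]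
  · rintro ⟨n, m⟩ h
    rcases Nat.eq_zero_or_pos n with rfl | hn
    · simp [powCoeff_zero (show a ≠ 0 by linarith)] at h
    · have hlt : n < m := by
        by_contra hlt
        simp [hlt] at h
      -- Solves r + 1 = n and r + s + 2 = m; the subtractions are exact since 0 < n < m.
      exact ⟨(n - 1, m - n - 1), by simp only [Prod.mk.injEq]; omega⟩

/-- The full product splits into n < m, n = m and n > m; `weightedSum` is the last part plus half
the diagonal. -/
theorem T_eq_zeta_mul_zeta_sub {a c : ℝ} (ha : 1 < a) (hc : 1 < c) :
    T a 0 c = (∑' n, powCoeff a n) * (∑' n, powCoeff c n) - (∑' n, powCoeff (a + c) n) / 2 -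
      weightedSum a c := by
  have hs := summable_powCoeff_mul ha hc
  have hlt : Summable fun p : ℕ × ℕ =>
      if p.1 < p.2 then powCoeff a p.1 * powCoeff c p.2 else 0 :=
    (hs.indicator {p : ℕ × ℕ | p.1 < p.2}).congr fun p => by
      simp only [Set.indicator_apply, Set.mem_ofPred_eq]
  have heq : Summable fun p : ℕ × ℕ =>
      if p.1 = p.2 then powCoeff a p.1 * powCoeff c p.2 else 0 :=
    (hs.indicator {p : ℕ × ℕ | p.1 = p.2}).congr fun p => by
      simp only [Set.indicator_apply, Set.mem_ofPred_eq]
  have hw : Summable fun p : ℕ × ℕ => halfWeight p.1 p.2 * (powCoeff a p.1 * powCoeff c p.2) := by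
    refine Summable.of_norm_bounded hs fun p => ?_
    have h0 := mul_nonneg (powCoeff_nonneg a p.1) (powCoeff_nonneg c p.2)
    rw [norm_mul, norm_of_nonneg h0]
    exact mul_le_of_le_one_left h0 (abs_halfWeight_le _ _)
  have hdiag : ∑' n, powCoeff (a + c) n =
      ∑' p : ℕ × ℕ, if p.1 = p.2 then powCoeff a p.1 * powCoeff c p.2 else 0 := by
    have hinj : Function.Injective fun n : ℕ => (n, n) := fun a b h => (Prod.mk.inj h).1
    rw [← hinj.tsum_eq
      (f := fun p : ℕ × ℕ => if p.1 = p.2 then powCoeff a p.1 * powCoeff c p.2 else 0)]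
    · refine tsum_congr fun n => ?_
      rw [if_pos rfl, powCoeff_mul_powCoeff _ _ _ (by linarith) (by linarith)]
    · rintro ⟨n, m⟩ h
      have : n = m := by
        by_contra hne
        simp [hne] at h
      exact ⟨n, by simp [this]⟩
  rw [T_eq_tsum_ite ha hc, (summable_powCoeff ha).tsum_mul_tsum (summable_powCoeff hc) hs, hdiag,
    weightedSum, ← tsum_div_const, ← hs.tsum_sub (heq.div_const 2),
    ← (hs.sub (heq.div_const 2)).tsum_sub hw]
  refine tsum_congr fun p => ?_
  unfold halfWeight
  split_ifs <;> first | omega | ring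

/-! ### Functional equations and the integral -/

/-- The factor `2 Γ(a) / (2π)^a` of the functional equation. -/
noncomputable def functionalCoeff (a : ℝ) : ℝ := 2 * (2 * π) ^ (-a) * Gamma a

theorem functionalCoeff_cast (a : ℝ) :
    (functionalCoeff a : ℂ) = 2 * (2 * π : ℂ) ^ (-a : ℂ) * Complex.Gamma a := by
  rw [functionalCoeff]
  push_cast
  rw [Complex.ofReal_cpow (by positivity), Complex.Gamma_ofReal]
  push_cast
  rfl

theorem lam_mul_functionalCoeff {a : ℝ} (ha : 0 < a) (hs : sin (π * a) ≠ 0) :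
    lam a * functionalCoeff a * sin (π * a) = 1 := by
  have hG : Gamma a ≠ 0 := (Gamma_pos_of_pos ha).ne'
  have hp : (2 * π) ^ (-a) ≠ 0 := (rpow_pos_of_pos (by positivity) _).ne'
  rw [lam_eq ha, functionalCoeff, sub_eq_add_neg, rpow_add (by positivity), rpow_one]
  field_simp

theorem ofReal_ne_neg_natCast {a : ℝ} (ha : 0 < a) (n : ℕ) : (a : ℂ) ≠ -n := by
  intro h
  have h' : a = -n := by exact_mod_cast h
  have : (0 : ℝ) ≤ n := n.cast_nonneg
  linarith

theorem riemannZeta_one_sub_ofReal {a : ℝ} (ha : 1 < a) :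
    riemannZeta (1 - a) =
      ((functionalCoeff a * cos (π * a / 2) * ∑' n, powCoeff a n : ℝ) : ℂ) := by
  rw [riemannZeta_one_sub (ofReal_ne_neg_natCast (by linarith)) (by exact_mod_cast ha.ne'),
    riemannZeta_eq_tsum_powCoeff ha]
  simp only [Complex.ofReal_mul, functionalCoeff_cast]
  push_cast
  rfl

theorem coe_one_sub (q : ℝ) : ((1 - q : ℝ) : UnitAddCircle) = -(q : UnitAddCircle) := by
  rw [AddCircle.coe_sub, AddCircle.coe_period, zero_sub]

theorem hurwitzZeta_sub_hurwitzZeta_one_sub {a : ℝ} (ha : 0 < a) (q : ℝ) :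
    HurwitzZeta.hurwitzZeta (q : UnitAddCircle) (1 - a) -
      HurwitzZeta.hurwitzZeta ((1 - q : ℝ) : UnitAddCircle) (1 - a) =
      2 * (functionalCoeff a * sin (π * a / 2) : ℝ) * HurwitzZeta.sinZeta q a := by
  have h := HurwitzZeta.hurwitzZetaOdd_eq (q : UnitAddCircle) (1 - a)
  rw [HurwitzZeta.hurwitzZetaOdd_one_sub _ (ofReal_ne_neg_natCast ha)] at h
  rw [coe_one_sub, Complex.ofReal_mul, functionalCoeff_cast]
  push_cast
  linear_combination -2 * h

theorem hurwitzZeta_one_sub_ofReal {c : ℝ} (hc : 1 < c) (q : ℝ) :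
    HurwitzZeta.hurwitzZeta (q : UnitAddCircle) (1 - c) = functionalCoeff c / 2 *
      (Complex.exp (-(π * c / 2 : ℝ) * Complex.I) *
          HurwitzZeta.expZeta (((1 : ℤ) * q : ℝ) : UnitAddCircle) c +
        Complex.exp ((π * c / 2 : ℝ) * Complex.I) *
          HurwitzZeta.expZeta (((-1 : ℤ) * q : ℝ) : UnitAddCircle) c) := by
  have e1 : (((1 : ℤ) * q : ℝ) : UnitAddCircle) = q := by simp
  have e2 : (((-1 : ℤ) * q : ℝ) : UnitAddCircle) = -(q : UnitAddCircle) := by simp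
  have e3 : -(π * c / 2 : ℝ) * Complex.I = -π * Complex.I * c / 2 := by push_cast; ring
  have e4 : (π * c / 2 : ℝ) * Complex.I = π * Complex.I * c / 2 := by push_cast; ring
  rw [HurwitzZeta.hurwitzZeta_one_sub _ (ofReal_ne_neg_natCast (by linarith))
    (Or.inr (by exact_mod_cast hc.ne')), functionalCoeff_cast, e1, e2, e3, e4]
  ring

/-- The continuous function that agrees with `integrand` on `(0, 1)`. -/
noncomputable def continuousIntegrand (a c q : ℝ) : ℂ :=
  functionalCoeff a * functionalCoeff c * (sin (π * a / 2) : ℝ) *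
    (Complex.exp (-(π * c / 2 : ℝ) * Complex.I) *
        (sinCotSum a q * HurwitzZeta.expZeta (((1 : ℤ) * q : ℝ) : UnitAddCircle) c) +
      Complex.exp ((π * c / 2 : ℝ) * Complex.I) *
        (sinCotSum a q * HurwitzZeta.expZeta (((-1 : ℤ) * q : ℝ) : UnitAddCircle) c))

theorem integrand_eq_continuousIntegrand {a c q : ℝ} (ha : 1 < a) (hc : 1 < c)
    (hq : q ∈ Set.Ioo 0 1) : integrand a c q = continuousIntegrand a c q := by
  have hsin : sin (π * q) ≠ 0 := by
    refine (sin_pos_of_pos_of_lt_pi (mul_pos pi_pos hq.1) ?_).ne'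
    nlinarith [pi_pos, hq.2]
  rw [integrand, hurwitzZeta_sub_hurwitzZeta_one_sub (by linarith), hurwitzZeta_one_sub_ofReal hc,
    continuousIntegrand, ← sinZeta_mul_cot ha hsin, Complex.ofReal_mul]
  ring

theorem continuous_sinCotSum_mul_expZeta {a c : ℝ} (ha : 2 < a) (hc : 1 < c) (e : ℤ) :
    Continuous fun q : ℝ =>
      sinCotSum a q * HurwitzZeta.expZeta ((e * q : ℝ) : UnitAddCircle) c :=
  (continuous_sinCotSum ha).mul
    ((continuous_expZeta hc).comp (continuous_const.mul continuous_id))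

theorem continuous_continuousIntegrand {a c : ℝ} (ha : 2 < a) (hc : 1 < c) :
    Continuous (continuousIntegrand a c) :=
  continuous_const.mul
    ((continuous_const.mul (continuous_sinCotSum_mul_expZeta ha hc 1)).add
      (continuous_const.mul (continuous_sinCotSum_mul_expZeta ha hc (-1))))

theorem intervalIntegrable_integrand {a c : ℝ} (ha : 2 < a) (hc : 1 < c) :
    IntervalIntegrable (integrand a c) volume 0 1 := by
  refine ((continuous_continuousIntegrand ha hc).intervalIntegrable 0 1).congr_uIoo fun q hq => ?_
  rw [Set.uIoo_of_le zero_le_one] at hq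
  exact (integrand_eq_continuousIntegrand (by linarith) hc hq).symm

theorem integral_integrand {a c : ℝ} (ha : 2 < a) (hc : 1 < c) :
    ∫ q in (0 : ℝ)..1, integrand a c q =
      ((2 * functionalCoeff a * functionalCoeff c * sin (π * a / 2) * cos (π * c / 2) *
        weightedSum a c : ℝ) : ℂ) := by
  -- Agreement on the open interval suffices; the endpoints, poles of the cotangent, form a null
  -- set.
  have h : ∫ q in (0 : ℝ)..1, integrand a c q = ∫ q in (0 : ℝ)..1, continuousIntegrand a c q :=
    intervalIntegral.integral_congr_uIoo fun q hq => by
      rw [Set.uIoo_of_le zero_le_one] at hq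
      exact integrand_eq_continuousIntegrand (by linarith) hc hq
  rw [h]
  unfold continuousIntegrand
  rw [intervalIntegral.integral_const_mul, intervalIntegral.integral_add,
    intervalIntegral.integral_const_mul, intervalIntegral.integral_const_mul,
    integral_sinCotSum_mul_expZeta ha hc (by rfl), integral_sinCotSum_mul_expZeta ha hc (by rfl)]
  -- The two exponentials multiply the same sum and add up to 2 cos(πc/2).
  · simp only [Complex.ofReal_mul, Complex.ofReal_cos (π * c / 2), Complex.cos]
    push_cast
    ring
  · exact (continuous_const.mul
      (continuous_sinCotSum_mul_expZeta ha hc 1)).intervalIntegrable _ _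
  · exact (continuous_const.mul
      (continuous_sinCotSum_mul_expZeta ha hc (-1))).intervalIntegrable _ _

/-! ### The quotient and its removable singularity -/

/-- The value of `quot` wherever `denom` does not vanish. -/
noncomputable def regularizedQuot (a c : ℝ) : ℝ :=
  functionalCoeff a * functionalCoeff c / 2 * cos (π * a / 2) * cos (π * c / 2) *
    ∑' n, powCoeff (a + c) n

theorem denom_mul_cos_mul_cos {a c : ℝ} (ha : cos (π * a / 2) ≠ 0) (hc : cos (π * c / 2) ≠ 0) :
    denom a c * (cos (π * a / 2) * cos (π * c / 2)) = cos (π * (a + c) / 2) := by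
  rw [denom, tan_eq_sin_div_cos, tan_eq_sin_div_cos,
    show π * (a + c) / 2 = π * a / 2 + π * c / 2 by ring, cos_add]
  field_simp

/-- The functional equation of ζ at a+c yields the factor cos(π(a+c)/2), which cancels the
denominator up to cosines, and B(a,c) = Γ(a)Γ(c)/Γ(a+c) gives K(a+c)B(a,c) = K(a)K(c)/2. -/
theorem quot_eq_regularizedQuot {a c : ℝ} (ha : 1 < a) (hc : 1 < c)
    (hca : cos (π * a / 2) ≠ 0) (hcc : cos (π * c / 2) ≠ 0) (hd : denom a c ≠ 0) :
    quot a c = (regularizedQuot a c : ℂ) := by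
  have hB := Complex.Gamma_mul_Gamma_eq_betaIntegral (s := a) (t := c)
    (by simp; linarith) (by simp; linarith)
  have hk : (functionalCoeff (a + c) : ℂ) * Complex.betaIntegral a c =
      functionalCoeff a * functionalCoeff c / 2 := by
    have hpow : (2 * π : ℂ) ^ (-(a + c : ℝ) : ℂ) =
        (2 * π : ℂ) ^ (-a : ℂ) * (2 * π : ℂ) ^ (-c : ℂ) := by
      rw [← Complex.cpow_add _ _ (by simp [pi_ne_zero])]
      congr 1
      push_cast
      ring
    rw [functionalCoeff_cast, functionalCoeff_cast, functionalCoeff_cast, hpow,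
      Complex.ofReal_add]
    linear_combination (-2 * (2 * π : ℂ) ^ (-a : ℂ) * (2 * π : ℂ) ^ (-c : ℂ)) * hB
  have harg : (1 - a - c : ℂ) = 1 - (a + c : ℝ) := by push_cast; ring
  have hd' : (denom a c : ℂ) ≠ 0 := by exact_mod_cast hd
  rw [quot, harg, riemannZeta_one_sub_ofReal (by linarith), div_eq_iff hd',
    ← denom_mul_cos_mul_cos hca hcc, regularizedQuot]
  push_cast
  linear_combination ((denom a c : ℂ) * (Complex.cos (π * a / 2) * Complex.cos (π * c / 2)) *
    ∑' n, (powCoeff (a + c) n : ℂ)) * hk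

theorem sin_pi_mul_ne_zero {a : ℝ} (ha : 0 < a) (haN : ∀ n : ℕ, a ≠ n) : sin (π * a) ≠ 0 := by
  rw [Ne, sin_eq_zero_iff]
  rintro ⟨n, hn⟩
  have h : a = n := mul_left_cancel₀ pi_ne_zero (by linarith)
  have hn0 : 0 < n := by exact_mod_cast h ▸ ha
  lift n to ℕ using hn0.le
  exact haN n (by exact_mod_cast h)

theorem sin_pi_mul_eq (a : ℝ) : sin (π * a) = 2 * sin (π * a / 2) * cos (π * a / 2) := by
  rw [← sin_two_mul]
  ring_nf

theorem cos_pi_mul_div_two_ne_zero {a : ℝ} (h : sin (π * a) ≠ 0) : cos (π * a / 2) ≠ 0 := by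
  rw [sin_pi_mul_eq] at h
  exact right_ne_zero_of_mul h

theorem T_eq_rhs_regularizedQuot {a c : ℝ} (ha : 2 < a) (hc : 1 < c) (hsa : sin (π * a) ≠ 0)
    (hsc : sin (π * c) ≠ 0) : (T a 0 c : ℂ) = rhs a c (regularizedQuot a c) := by
  rw [rhs, integral_integrand ha hc, riemannZeta_one_sub_ofReal (by linarith),
    riemannZeta_one_sub_ofReal hc, T_eq_zeta_mul_zeta_sub (by linarith) hc, regularizedQuot]
  have h1 := lam_mul_functionalCoeff (by linarith) hsa
  have h2 := lam_mul_functionalCoeff (by linarith) hsc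
  rw [sin_pi_mul_eq] at h1 h2
  have h3 : (lam a * functionalCoeff a * (2 * sin (π * a / 2) * cos (π * a / 2))) *
      (lam c * functionalCoeff c * (2 * sin (π * c / 2) * cos (π * c / 2))) = 1 := by
    rw [h1, h2, one_mul]
  have h4 := congrArg ((↑) : ℝ → ℂ) h3
  push_cast at h4 ⊢
  linear_combination -((∑' n, (powCoeff a n : ℂ)) * (∑' n, (powCoeff c n : ℂ)) -
    (∑' n, (powCoeff (a + c) n : ℂ)) / 2 - weightedSum a c) * h4

theorem continuousAt_tsum_powCoeff {a : ℝ} (ha : 1 < a) :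
    ContinuousAt (fun x => ((∑' n, powCoeff x n : ℝ) : ℂ)) a := by
  have h : ContinuousAt (fun x : ℝ => riemannZeta x) a :=
    ContinuousAt.comp (f := fun x : ℝ => (x : ℂ))
      (differentiableAt_riemannZeta (by exact_mod_cast ha.ne')).continuousAt
      Complex.continuous_ofReal.continuousAt
  refine h.congr ?_
  filter_upwards [lt_mem_nhds ha] with x hx
  exact riemannZeta_eq_tsum_powCoeff hx

theorem continuousAt_regularizedQuot {a c : ℝ} (ha : 1 < a) (hc : 0 < c) :
    ContinuousAt (fun x => (regularizedQuot x c : ℂ)) a := by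
  have hG : ContinuousAt Gamma a :=
    (differentiableAt_Gamma fun n hn => ofReal_ne_neg_natCast (a := a) (by linarith) n
      (by exact_mod_cast hn)).continuousAt
  have hk : ContinuousAt functionalCoeff a := by
    unfold functionalCoeff
    refine (continuousAt_const.mul ?_).mul hG
    exact continuousAt_const.rpow continuousAt_id.neg (Or.inl (by positivity))
  have hz : ContinuousAt (fun x => ((∑' n, powCoeff (x + c) n : ℝ) : ℂ)) a :=
    ContinuousAt.comp (f := fun x => x + c)
      (continuousAt_tsum_powCoeff (a := a + c) (by linarith)) (by fun_prop)
  unfold regularizedQuot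
  simp only [Complex.ofReal_mul _ (∑' n, powCoeff (_ + c) n)]
  refine ContinuousAt.mul (Complex.continuous_ofReal.continuousAt.comp ?_) hz
  fun_prop

/-- The zero of cos(π(x+c)/2) at x = a is simple, so the denominator is nonzero on a punctured
neighbourhood, where the quotient equals a function continuous at a. -/
theorem tendsto_quot {a c : ℝ} (ha : 1 < a) (hc : 1 < c) (hca : cos (π * a / 2) ≠ 0)
    (hcc : cos (π * c / 2) ≠ 0) (hd : denom a c = 0) :
    Tendsto (fun x : ℝ => quot x c) (𝓝[≠] a) (𝓝 (regularizedQuot a c)) := by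
  have hz : cos (π * (a + c) / 2) = 0 := by
    rw [← denom_mul_cos_mul_cos hca hcc, hd, zero_mul]
  have hderiv : HasDerivAt (fun x => cos (π * (x + c) / 2)) (-sin (π * (a + c) / 2) * (π / 2)) a := by
    refine HasDerivAt.cos ?_
    have := (((hasDerivAt_id a).add_const c).const_mul π).div_const 2
    simpa using this
  have hne : -sin (π * (a + c) / 2) * (π / 2) ≠ 0 := by
    have := sin_sq_add_cos_sq (π * (a + c) / 2)
    refine mul_ne_zero (neg_ne_zero.2 fun h => ?_) (by positivity)
    rw [h, hz] at this
    norm_num at this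
  have hcos : ∀ᶠ x in 𝓝 a, cos (π * x / 2) ≠ 0 :=
    ContinuousAt.eventually_ne (by fun_prop) hca
  refine ((continuousAt_regularizedQuot ha (by linarith)).tendsto.mono_left
    nhdsWithin_le_nhds).congr' ?_
  filter_upwards [hderiv.eventually_ne (c := 0) hne, nhdsWithin_le_nhds hcos,
    nhdsWithin_le_nhds (lt_mem_nhds ha)] with x hx hxc hx1
  refine (quot_eq_regularizedQuot hx1 hc hxc hcc fun h => hx ?_).symm
  rw [← denom_mul_cos_mul_cos hxc hcc, h, zero_mul]

end Tornheim

/-- The double series and the integral converge, and `T(a,0,c)` is given by the formula. When the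
denominator `1 - tan(πa/2) tan(πc/2)` is zero, the quotient in the formula is read as its limit. -/
theorem theorem2p1 (a c : ℝ) (ha : 2 < a) (hc : 2 < c)
    (haN : ∀ n : ℕ, a ≠ n) (hcN : ∀ n : ℕ, c ≠ n) :
    Summable (fun p : ℕ × ℕ => Tornheim.term a 0 c p.1 p.2) ∧
    IntervalIntegrable (Tornheim.integrand a c) MeasureTheory.volume 0 1 ∧
    (Tornheim.denom a c ≠ 0 →
      (Tornheim.T a 0 c : ℂ) = Tornheim.rhs a c (Tornheim.quot a c)) ∧
    (Tornheim.denom a c = 0 →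
      ∃ D : ℂ, Tendsto (fun x : ℝ => Tornheim.quot x c) (𝓝[≠] a) (𝓝 D) ∧
        (Tornheim.T a 0 c : ℂ) = Tornheim.rhs a c D) := by
  have hsa := Tornheim.sin_pi_mul_ne_zero (by linarith) haN
  have hsc := Tornheim.sin_pi_mul_ne_zero (by linarith) hcN
  have hca := Tornheim.cos_pi_mul_div_two_ne_zero hsa
  have hcc := Tornheim.cos_pi_mul_div_two_ne_zero hsc
  have hT := Tornheim.T_eq_rhs_regularizedQuot ha (by linarith) hsa hsc
  refine ⟨Tornheim.summable_term (by linarith) (by linarith),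
    Tornheim.intervalIntegrable_integrand ha (by linarith), fun hd => ?_, fun hd => ?_⟩
  · rw [hT, Tornheim.quot_eq_regularizedQuot (by linarith) (by linarith) hca hcc hd]
  · exact ⟨_, Tornheim.tendsto_quot (by linarith) (by linarith) hca hcc hd, hT⟩
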